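/- Let $d \ge 3$, let $\mathcal H$ be a $d$-dimensional complex Hilbert space with a fixed orthonormal basis, and let $\mathcal H_A$ be an arbitrary complex Hilbert space (the ancilla). For a unitary $W$ on a Hilbert space write $\mathcal U_W(X) = W X W^\dagger$, and for a unitary $U$ on $\mathcal H$ let $U^*$ denote the unitary whose matrix in the fixed basis is the entrywise complex conjugate of that of $U$. Then there is no triple $(\epsilon, \mathcal E, \mathcal D)$ consisting of a real number $\epsilon > 0$ and completely positive trace non-increasing linear maps $$\mathcal E : \mathcal B(\mathcal H) \to \mathcal B(\mathcal H \otimes \mathcal H_A), \qquad \mathcal D : \mathcal B(\mathcal H \otimes \mathcal H_A) \to \mathcal B(\mathcal H)$$ such that for every unitary $U$ on $\mathcal H$ and every density operator $\rho$ on $\mathcal H$ $$\operatorname{Tr}\bigl[\mathcal D \circ (\mathcal U_U \otimes \mathrm{id}_{\mathcal H_A}) \circ \mathcal E(\rho)\bigr] \ge \epsilon \qquad\text{and}\qquad \mathcal D \circ (\mathcal U_U \otimes \mathrm{id}_{\mathcal H_A}) \circ \mathcal E(\rho) \propto \mathcal U_{U^*}(\rho) = U^* \rho\, U^{T},$$ where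 the factor of proportionality may depend on $U$ and $\rho$. (If $\mathcal H_A$ is infinite dimensional, complete positivity and the trace condition are required only on trace class operators, so that maps defined only on the trace class are covered as well.) -/

import Mathlib

open scoped TensorProduct ComplexOrder InnerProductSpace

noncomputable section

namespace QuantumOp

variable {K : Type*} [NormedAddCommGroup K] [InnerProductSpace ℂ K]
variable {L : Type*} [NormedAddCommGroup L] [InnerProductSpace ℂ L]

/-- The trace of a positive bounded operator `X`, with values in `[0, ∞]`: the supremum of the sums
`∑ ⟨v, X v⟩` over all finite orthonormal families. -/
def posTrace (X : K →L[ℂ] K) : ENNReal :=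
  ⨆ (s : Finset K) (_ : Orthonormal ℂ (fun v : s => (v : K))),
    ∑ v ∈ s, ENNReal.ofReal (⟪v, X v⟫_ℂ).re

/-- The trace class operators on `K`: linear combinations of positive bounded operators of finite
trace. If `K` is finite dimensional, these are all the operators on `K`. -/
def traceClass (K : Type*) [NormedAddCommGroup K] [InnerProductSpace ℂ K] :
    Submodule ℂ (K →L[ℂ] K) :=
  Submodule.span ℂ {X | X.IsPositive ∧ posTrace X < ⊤}

/-- The operator `∑ i j, |i⟩⟨j| ⊗ X i j` on `ℂⁿ ⊗ K` is positive. -/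
def BlockPositive {n : ℕ} (X : Fin n → Fin n → (K →L[ℂ] K)) : Prop :=
  ∀ v : Fin n → K, 0 ≤ ∑ i, ∑ j, ⟪v i, X i j (v j)⟫_ℂ

/-- Complete positivity, tested on trace class operators: for every `n`, the map `id ⊗ Φ`, where
`id` is the identity map of the operators on `ℂⁿ`, sends positive operators to positive ones. -/
def IsCompletelyPositive (Φ : (K →L[ℂ] K) →ₗ[ℂ] (L →L[ℂ] L)) : Prop :=
  ∀ (n : ℕ) (X : Fin n → Fin n → (K →L[ℂ] K)), (∀ i j, X i j ∈ traceClass K) →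
    BlockPositive X → BlockPositive fun i j => Φ (X i j)

/-- The trace is not increased on positive operators (this is no condition on those of infinite
trace). -/
def IsTraceNonincreasing (Φ : (K →L[ℂ] K) →ₗ[ℂ] (L →L[ℂ] L)) : Prop :=
  ∀ X : K →L[ℂ] K, X.IsPositive → posTrace (Φ X) ≤ posTrace X

/-- `Φ` acts on trace class operators as a completely positive trace non-increasing map. In finite
dimension this is the usual notion. In infinite dimension nothing is required of the values of `Φ`
outside the trace class, so that every completely positive trace non-increasing linear map which is
only defined on the trace class is covered too (extend it linearly in any way). -/
structure IsQuantumOperation (Φ : (K →L[ℂ] K) →ₗ[ℂ] (L →L[ℂ] L)) : Prop where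
  completelyPositive : IsCompletelyPositive Φ
  traceNonincreasing : IsTraceNonincreasing Φ

/-- The unitary channel `X ↦ W X W†` of the unitary `W`. -/
def unitaryChannel (W : K ≃ₗᵢ[ℂ] K) (X : K →L[ℂ] K) : K →L[ℂ] K :=
  (W : K →L[ℂ] K) ∘L X ∘L (W.symm : K →L[ℂ] K)

/-- Density operators on a finite dimensional Hilbert space. -/
structure IsState (ρ : K →L[ℂ] K) : Prop where
  isPositive : ρ.IsPositive
  trace_eq_one : LinearMap.trace ℂ K (ρ : K →ₗ[ℂ] K) = 1

/-- The operator whose matrix in the orthonormal basis `e` is the entrywise complex conjugate of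
the matrix of `X`. -/
def conjOp {d : ℕ} (e : OrthonormalBasis (Fin d) ℂ K) (X : K →ₗ[ℂ] K) : K →ₗ[ℂ] K :=
  Matrix.toLin e.toBasis e.toBasis ((LinearMap.toMatrix e.toBasis e.toBasis X).map star)

theorem conjOp_comp {d : ℕ} (e : OrthonormalBasis (Fin d) ℂ K) (X Y : K →ₗ[ℂ] K) :
    conjOp e X ∘ₗ conjOp e Y = conjOp e (X ∘ₗ Y) := by
  unfold conjOp
  rw [← Matrix.toLin_mul, LinearMap.toMatrix_comp e.toBasis e.toBasis e.toBasis]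
  congr 1
  ext i j
  simp [Matrix.mul_apply]

theorem conjOp_id {d : ℕ} (e : OrthonormalBasis (Fin d) ℂ K) :
    conjOp e (LinearMap.id : K →ₗ[ℂ] K) = LinearMap.id := by
  unfold conjOp
  rw [LinearMap.toMatrix_id, Matrix.map_one star (star_zero _) (star_one _), Matrix.toLin_one]

theorem inner_conjOp {d : ℕ} (e : OrthonormalBasis (Fin d) ℂ K) (X : K →ₗ[ℂ] K) (i j : Fin d) :
    ⟪e i, conjOp e X (e j)⟫_ℂ = star ⟪e i, X (e j)⟫_ℂ := by
  rw [← e.repr_apply_apply, ← e.repr_apply_apply, ← e.coe_toBasis_repr_apply,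
    ← e.coe_toBasis_repr_apply, ← e.coe_toBasis, ← LinearMap.toMatrix_apply,
    ← LinearMap.toMatrix_apply, conjOp, LinearMap.toMatrix_toLin, Matrix.map_apply]

theorem inner_conjOp_comm {d : ℕ} (e : OrthonormalBasis (Fin d) ℂ K) (U : K ≃ₗᵢ[ℂ] K) (x y : K) :
    ⟪conjOp e (U.toLinearEquiv : K →ₗ[ℂ] K) x, y⟫_ℂ =
      ⟪x, conjOp e (U.symm.toLinearEquiv : K →ₗ[ℂ] K) y⟫_ℂ := by
  have key : (innerₛₗ ℂ : K →ₗ⋆[ℂ] K →ₗ[ℂ] ℂ) ∘ₛₗ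
        conjOp e (U.toLinearEquiv : K →ₗ[ℂ] K) =
      ((innerₛₗ ℂ : K →ₗ⋆[ℂ] K →ₗ[ℂ] ℂ).compl₂
        (conjOp e (U.symm.toLinearEquiv : K →ₗ[ℂ] K))) := by
    refine e.toBasis.ext fun i => e.toBasis.ext fun j => ?_
    simp only [LinearMap.comp_apply, LinearMap.compl₂_apply, innerₛₗ_apply_apply, e.coe_toBasis]
    rw [inner_conjOp, ← inner_conj_symm, inner_conjOp]
    have h : ⟪U (e i), e j⟫_ℂ = ⟪e i, U.symm (e j)⟫_ℂ := by
      rw [← U.inner_map_map (e i), U.apply_symm_apply]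
    have h' := congrArg star h
    rw [← inner_conj_symm (U (e i))] at h'
    simpa using h'
  have := congrArg (fun f => f x y) key
  simpa using this

/-- The complex conjugate `U*` of the unitary `U` in the orthonormal basis `e`. -/
def conjUnitary {d : ℕ} (e : OrthonormalBasis (Fin d) ℂ K) (U : K ≃ₗᵢ[ℂ] K) : K ≃ₗᵢ[ℂ] K :=
  LinearEquiv.isometryOfInner
    (LinearEquiv.ofLinearMap (conjOp e (U.toLinearEquiv : K →ₗ[ℂ] K))
      (conjOp e (U.symm.toLinearEquiv : K →ₗ[ℂ] K))
      (by
        rw [conjOp_comp]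
        convert conjOp_id e
        ext x
        simp)
      (by
        rw [conjOp_comp]
        convert conjOp_id e
        ext x
        simp))
    (by
      intro x y
      simp only [LinearEquiv.coe_ofLinearMap]
      rw [inner_conjOp_comm, ← LinearMap.comp_apply, conjOp_comp]
      have : (U.symm.toLinearEquiv : K →ₗ[ℂ] K) ∘ₗ (U.toLinearEquiv : K →ₗ[ℂ] K) =
          LinearMap.id := by
        ext x
        simp
      rw [this, conjOp_id, LinearMap.id_apply])

end QuantumOp

end

/-! Diagonal unitaries already give the contradiction. With phases `z`, the protocol output is `∑ i
k, z i * conj (z k) * D (P i E(ρ) P k)`, where `P i` is `coordProj`. On the matrix unit `(a, b)` it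
must be `p z * conj (z a) * z b`; linearity makes the factor `p z` independent of the input
(`exists_eq_smul_unitaryChannel`). Let `ψ i k a b` be the coefficients (`protocolCoeff`) and `p₀ >
0` the mean of `p` over cubic phases. Averaging at `a = b` gives `∑ i, ψ i i a a = p₀`; averaging
against `z a * conj (z b)` gives `ψ b a a b = p₀` for `a ≠ b`. Complete positivity makes `ψ`
positive in the pairs `(i, a)`, `(k, b)`, so `ψ b b a a + ψ a a b b ≥ 2 p₀`. Three indices then give
a total of at least `6 p₀`, while the three sums over `i` allow at most `3 p₀`.

For infinite dimensional `A`, complete positivity of `D` may be used only on trace class blocks, so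
`P i X P k` has to be shown trace class. -/

noncomputable section

namespace QuantumOp

/-! ### Trace class operators and positivity of blocks -/

section TraceClass

variable {K : Type*} [NormedAddCommGroup K] [InnerProductSpace ℂ K]
variable {L : Type*} [NormedAddCommGroup L] [InnerProductSpace ℂ L]

theorem isPositive_iff_inner {X : K →L[ℂ] K} : X.IsPositive ↔ ∀ v, 0 ≤ ⟪v, X v⟫_ℂ := by
  refine ⟨fun h v => h.inner_nonneg_right v, fun h => ?_⟩
  rw [ContinuousLinearMap.isPositive_iff_complex]
  intro v
  have hv := h v
  have h' : ⟪X v, v⟫_ℂ = ⟪v, X v⟫_ℂ := by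
    rw [← inner_conj_symm]
    exact (IsSelfAdjoint.of_nonneg hv).star_eq
  rw [h']
  rw [Complex.le_def] at hv
  exact ⟨Complex.ext rfl hv.2, hv.1⟩

theorem posTrace_mono {X Y : K →L[ℂ] K} (h : ∀ v, (⟪v, X v⟫_ℂ).re ≤ (⟪v, Y v⟫_ℂ).re) :
    posTrace X ≤ posTrace Y :=
  iSup₂_mono fun _ _ => Finset.sum_le_sum fun v _ => ENNReal.ofReal_le_ofReal (h v)

theorem posTrace_add_le (X Y : K →L[ℂ] K) : posTrace (X + Y) ≤ posTrace X + posTrace Y := by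
  refine iSup₂_le fun s hs => ?_
  calc ∑ v ∈ s, ENNReal.ofReal (⟪v, (X + Y) v⟫_ℂ).re
      ≤ ∑ v ∈ s, (ENNReal.ofReal (⟪v, X v⟫_ℂ).re + ENNReal.ofReal (⟪v, Y v⟫_ℂ).re) := by
        refine Finset.sum_le_sum fun v _ => ?_
        rw [add_apply, inner_add_right, Complex.add_re]
        exact ENNReal.ofReal_add_le
    _ ≤ posTrace X + posTrace Y := by
        rw [Finset.sum_add_distrib]
        exact add_le_add (le_iSup₂_of_le s hs le_rfl) (le_iSup₂_of_le s hs le_rfl)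

@[simp]
theorem unitaryChannel_apply (W : K ≃ₗᵢ[ℂ] K) (X : K →L[ℂ] K) (v : K) :
    unitaryChannel W X v = W (X (W.symm v)) := rfl

theorem inner_unitaryChannel (W : K ≃ₗᵢ[ℂ] K) (X : K →L[ℂ] K) (v w : K) :
    ⟪v, unitaryChannel W X w⟫_ℂ = ⟪W.symm v, X (W.symm w)⟫_ℂ := by
  rw [unitaryChannel_apply, ← W.inner_map_map (W.symm v), W.apply_symm_apply]

theorem posTrace_unitaryChannel_le (W : K ≃ₗᵢ[ℂ] K) (X : K →L[ℂ] K) :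
    posTrace (unitaryChannel W X) ≤ posTrace X := by
  refine iSup₂_le fun s hs => ?_
  have hs' : Orthonormal ℂ
      (fun v : s.map W.symm.toLinearEquiv.toEquiv.toEmbedding => (v : K)) := by
    refine ⟨?_, ?_⟩
    · rintro ⟨v, hv⟩
      obtain ⟨u, hu, rfl⟩ := Finset.mem_map.1 hv
      simpa using hs.1 ⟨u, hu⟩
    · rintro ⟨v, hv⟩ ⟨w, hw⟩ hvw
      obtain ⟨u, hu, rfl⟩ := Finset.mem_map.1 hv
      obtain ⟨t, ht, rfl⟩ := Finset.mem_map.1 hw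
      have hut : (⟨u, hu⟩ : s) ≠ ⟨t, ht⟩ := by
        rintro h
        exact hvw (by simpa using h)
      simpa using hs.2 hut
  refine le_iSup₂_of_le _ hs' (le_of_eq ?_)
  rw [Finset.sum_map]
  refine Finset.sum_congr rfl fun v _ => ?_
  rw [inner_unitaryChannel]
  rfl

theorem mem_traceClass_of_isPositive {X : K →L[ℂ] K} (h : X.IsPositive) (ht : posTrace X < ⊤) :
    X ∈ traceClass K :=
  Submodule.subset_span ⟨h, ht⟩

theorem isPositive_unitaryChannel (W : K ≃ₗᵢ[ℂ] K) {X : K →L[ℂ] K} (h : X.IsPositive) :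
    (unitaryChannel W X).IsPositive := by
  rw [isPositive_iff_inner] at h ⊢
  intro v
  rw [inner_unitaryChannel]
  exact h _

theorem unitaryChannel_mem_traceClass (W : K ≃ₗᵢ[ℂ] K) {X : K →L[ℂ] K} (hX : X ∈ traceClass K) :
    unitaryChannel W X ∈ traceClass K := by
  induction hX using Submodule.span_induction with
  | mem X h =>
    exact mem_traceClass_of_isPositive (isPositive_unitaryChannel W h.1)
      ((posTrace_unitaryChannel_le W X).trans_lt h.2)
  | zero =>
    convert (traceClass K).zero_mem
    ext v
    simp
  | add X Y _ _ hX hY =>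
    convert (traceClass K).add_mem hX hY using 1
    ext v
    simp
  | smul c X _ hX =>
    convert (traceClass K).smul_mem c hX using 1
    ext v
    simp

/-- `W† X W` for `W = 1 + c U`. -/
def polarized (X : K →L[ℂ] K) (U : K ≃ₗᵢ[ℂ] K) (c : ℂ) : K →L[ℂ] K :=
  (ContinuousLinearMap.id ℂ K + star c • (U.symm : K →L[ℂ] K)) ∘L X ∘L
    (ContinuousLinearMap.id ℂ K + c • (U : K →L[ℂ] K))

theorem inner_polarized (X : K →L[ℂ] K) (U : K ≃ₗᵢ[ℂ] K) (c : ℂ) (v : K) :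
    ⟪v, polarized X U c v⟫_ℂ = ⟪v + c • U v, X (v + c • U v)⟫_ℂ := by
  have h (y : K) : ⟪v, U.symm y⟫_ℂ = ⟪U v, y⟫_ℂ := by
    rw [← U.inner_map_map, U.apply_symm_apply]
  simp [polarized, h]
  ring

/-- Parallelogram law: for `|c| = 1` the forms of `X` at `v + c U v` and `v - c U v` add up to that
of `2 X + 2 U† X U`, which has finite trace, and the second form is nonnegative. -/
theorem polarized_mem_traceClass {X : K →L[ℂ] K} (hX : X.IsPositive) (ht : posTrace X < ⊤)
    (U : K ≃ₗᵢ[ℂ] K) {c : ℂ} (hc : star c * c = 1) : polarized X U c ∈ traceClass K := by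
  rw [isPositive_iff_inner] at hX
  refine mem_traceClass_of_isPositive ?_ ?_
  · rw [isPositive_iff_inner]
    intro v
    rw [inner_polarized]
    exact hX _
  · have hU := posTrace_unitaryChannel_le U.symm X
    refine (posTrace_mono (Y := (X + X) + (unitaryChannel U.symm X + unitaryChannel U.symm X))
      fun v => ?_).trans_lt (((posTrace_add_le _ _).trans
        (add_le_add (posTrace_add_le _ _) ((posTrace_add_le _ _).trans
          (add_le_add hU hU)))).trans_lt (by simp [ht]))
    have h := (Complex.le_def.1 (hX (v - c • U v))).1
    rw [inner_polarized]
    have h2 : ⟪v + c • U v, X (v + c • U v)⟫_ℂ + ⟪v - c • U v, X (v - c • U v)⟫_ℂ =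
        ⟪v, ((X + X) + (unitaryChannel U.symm X + unitaryChannel U.symm X)) v⟫_ℂ := by
      simp only [add_apply, inner_add_right, inner_unitaryChannel, map_add, map_sub, map_smul,
        inner_sub_right, inner_sub_left, inner_add_left, inner_smul_left, inner_smul_right,
        LinearIsometryEquiv.symm_symm, starRingEnd_apply]
      linear_combination (2 * ⟪U v, X (U v)⟫_ℂ) * hc
    have h3 := congrArg Complex.re h2
    rw [Complex.add_re] at h3
    rw [← h3]
    simpa using h

theorem comp_unitary_mem_traceClass {X : K →L[ℂ] K} (hX : X ∈ traceClass K) (U : K ≃ₗᵢ[ℂ] K) :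
    X ∘L (U : K →L[ℂ] K) ∈ traceClass K := by
  induction hX using Submodule.span_induction with
  | mem X h =>
    -- Weighting `(1 + c U)† X (1 + c U)` by `conj c` over the fourth roots of unity isolates the
    -- term `c X U`.
    have key : X ∘L (U : K →L[ℂ] K) = (4 : ℂ)⁻¹ •
        (polarized X U 1 - polarized X U (-1) -
          Complex.I • polarized X U Complex.I + Complex.I • polarized X U (-Complex.I)) := by
      ext v
      simp [polarized, smul_add, smul_smul]
      module
    rw [key]
    have hp {c : ℂ} (hc : star c * c = 1) := polarized_mem_traceClass h.1 h.2 U hc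
    refine Submodule.smul_mem _ _ (add_mem (sub_mem (sub_mem (hp ?_) (hp ?_))
      (Submodule.smul_mem _ _ (hp ?_))) (Submodule.smul_mem _ _ (hp ?_))) <;> simp
  | zero => simp
  | add X Y _ _ hX hY => simpa [ContinuousLinearMap.add_comp] using add_mem hX hY
  | smul c X _ hX =>
    simpa [ContinuousLinearMap.smul_comp] using (traceClass K).smul_mem c hX

/-- `U X = (U X U†) U` reduces this to multiplication on the right. -/
theorem unitary_comp_mem_traceClass {X : K →L[ℂ] K} (hX : X ∈ traceClass K) (U : K ≃ₗᵢ[ℂ] K) :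
    (U : K →L[ℂ] K) ∘L X ∈ traceClass K := by
  convert comp_unitary_mem_traceClass (unitaryChannel_mem_traceClass U hX) U using 1
  ext v
  simp

theorem isPositive_rankOne (x : K) : (InnerProductSpace.rankOne ℂ x x).IsPositive := by
  rw [isPositive_iff_inner]
  intro v
  rw [InnerProductSpace.inner_right_rankOne_apply, ← inner_conj_symm v x, mul_comm]
  exact mul_star_self_nonneg _

/-- Bessel's inequality bounds the trace by `‖x‖ ^ 2`. -/
theorem posTrace_rankOne_lt_top (x : K) : posTrace (InnerProductSpace.rankOne ℂ x x) < ⊤ := by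
  refine lt_of_le_of_lt (iSup₂_le fun s hs => ?_) (ENNReal.ofReal_lt_top (r := ‖x‖ ^ 2))
  rw [← ENNReal.ofReal_sum_of_nonneg]
  · refine ENNReal.ofReal_le_ofReal (le_trans (le_of_eq ?_) (hs.sum_inner_products_le x
      (s := Finset.univ)))
    rw [← Finset.sum_coe_sort s]
    refine Finset.sum_congr rfl fun v _ => ?_
    rw [InnerProductSpace.inner_right_rankOne_apply, ← sq_abs, abs_norm, sq]
    exact (inner_mul_symm_re_eq_norm (𝕜 := ℂ) (v : K) x).trans (by rw [norm_mul, norm_inner_symm x])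
  · intro v _
    exact (Complex.le_def.1 ((isPositive_rankOne x).inner_nonneg_right v)).1

theorem rankOne_polarization (x y : K) : InnerProductSpace.rankOne ℂ x y = (4 : ℂ)⁻¹ •
    (InnerProductSpace.rankOne ℂ (x + y) (x + y) - InnerProductSpace.rankOne ℂ (x - y) (x - y)
      + Complex.I • InnerProductSpace.rankOne ℂ (x + Complex.I • y) (x + Complex.I • y)
      - Complex.I • InnerProductSpace.rankOne ℂ (x - Complex.I • y) (x - Complex.I • y)) := by
  ext v
  simp [smul_add, smul_sub, smul_smul]
  module

theorem rankOne_mem_of_forall_self {S : Submodule ℂ (K →L[ℂ] K)}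
    (h : ∀ x, InnerProductSpace.rankOne ℂ x x ∈ S) (x y : K) :
    InnerProductSpace.rankOne ℂ x y ∈ S := by
  rw [rankOne_polarization]
  exact S.smul_mem _ (sub_mem (add_mem (sub_mem (h _) (h _)) (S.smul_mem _ (h _)))
    (S.smul_mem _ (h _)))

theorem rankOne_mem_traceClass (x y : K) : InnerProductSpace.rankOne ℂ x y ∈ traceClass K :=
  rankOne_mem_of_forall_self (fun x => mem_traceClass_of_isPositive (isPositive_rankOne x)
    (posTrace_rankOne_lt_top x)) x y

theorem IsCompletelyPositive.isPositive {Φ : (K →L[ℂ] K) →ₗ[ℂ] (L →L[ℂ] L)}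
    (hΦ : IsCompletelyPositive Φ) {X : K →L[ℂ] K} (hX : X.IsPositive) (ht : posTrace X < ⊤) :
    (Φ X).IsPositive := by
  rw [isPositive_iff_inner]
  intro v
  have := hΦ 1 (fun _ _ => X) (fun _ _ => mem_traceClass_of_isPositive hX ht)
    (fun w => by simpa using hX.inner_nonneg_right (w 0)) (fun _ => v)
  simpa using this

theorem IsQuantumOperation.apply_mem_traceClass {Φ : (K →L[ℂ] K) →ₗ[ℂ] (L →L[ℂ] L)}
    (hΦ : IsQuantumOperation Φ) {X : K →L[ℂ] K} (hX : X ∈ traceClass K) :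
    Φ X ∈ traceClass L := by
  suffices traceClass K ≤ (traceClass L).comap Φ from this hX
  refine Submodule.span_le.2 fun Y hY => ?_
  exact mem_traceClass_of_isPositive (hΦ.completelyPositive.isPositive hY.1 hY.2)
    ((hΦ.traceNonincreasing Y hY.1).trans_lt hY.2)

/-- The quadratic form is `|∑ i, ⟪v i, x i⟫| ^ 2`. -/
theorem blockPositive_rankOne {n : ℕ} (x : Fin n → K) :
    BlockPositive fun r s => InnerProductSpace.rankOne ℂ (x r) (x s) := by
  intro v
  have : ∑ i, ∑ j, ⟪v i, InnerProductSpace.rankOne ℂ (x i) (x j) (v j)⟫_ℂ =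
      (∑ i, ⟪v i, x i⟫_ℂ) * star (∑ i, ⟪v i, x i⟫_ℂ) := by
    rw [star_sum, Finset.sum_mul_sum]
    refine Finset.sum_congr rfl fun i _ => Finset.sum_congr rfl fun j _ => ?_
    rw [InnerProductSpace.inner_right_rankOne_apply, ← inner_conj_symm (x j)]
    rfl
  rw [this]
  exact mul_star_self_nonneg _

/-- Compressing a positive block operator by symmetric operators keeps it positive. -/
theorem BlockPositive.compress {n : ℕ} {X : Fin n → Fin n → (K →L[ℂ] K)} (hX : BlockPositive X)
    {P : Fin n → (K →L[ℂ] K)} (hP : ∀ r v w, ⟪v, P r w⟫_ℂ = ⟪P r v, w⟫_ℂ) :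
    BlockPositive fun r s => P r ∘L X r s ∘L P s := by
  intro v
  simpa [hP] using hX fun r => P r (v r)

theorem inner_half_id_sub {V : K ≃ₗᵢ[ℂ] K} (hV : V.symm = V) (v w : K) :
    ⟪v, ((2 : ℂ)⁻¹ • (ContinuousLinearMap.id ℂ K - (V : K →L[ℂ] K))) w⟫_ℂ =
      ⟪((2 : ℂ)⁻¹ • (ContinuousLinearMap.id ℂ K - (V : K →L[ℂ] K))) v, w⟫_ℂ := by
  have h : ⟪v, V w⟫_ℂ = ⟪V v, w⟫_ℂ := by
    conv_lhs => rw [← hV, ← V.inner_map_map, V.apply_symm_apply]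
  simp [h]
  ring

end TraceClass

/-! ### Diagonal unitaries and coordinate projections -/

section DiagonalUnitary

variable {d : ℕ} {H : Type*} [NormedAddCommGroup H] [InnerProductSpace ℂ H]
variable (e : OrthonormalBasis (Fin d) ℂ H)
variable {A : Type*} [NormedAddCommGroup A] [InnerProductSpace ℂ A]

/-- The orthonormal basis obtained by multiplying the vectors of `e` by the phases `z`. -/
def phaseBasis (z : Fin d → Circle) : OrthonormalBasis (Fin d) ℂ H :=
  (e.toBasis.unitsSMul fun i => Circle.toUnits (z i)).toOrthonormalBasis (by
    refine ⟨fun i => ?_, fun i j hij => ?_⟩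
    · simp [Module.Basis.unitsSMul_apply, Units.smul_def, norm_smul, Circle.norm_coe]
    · simp [Module.Basis.unitsSMul_apply, Units.smul_def, inner_smul_left, inner_smul_right,
        e.orthonormal.2 hij])

theorem phaseBasis_apply (z : Fin d → Circle) (i : Fin d) :
    phaseBasis e z i = (z i : ℂ) • e i := by
  simp [phaseBasis, Module.Basis.unitsSMul_apply, Units.smul_def]

/-- The unitary which is diagonal in the basis `e` with the phases `z` on the diagonal. -/
def diagUnitary (z : Fin d → Circle) : H ≃ₗᵢ[ℂ] H :=
  e.equiv (phaseBasis e z) (Equiv.refl _)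

@[simp]
theorem diagUnitary_apply (z : Fin d → Circle) (i : Fin d) :
    diagUnitary e z (e i) = (z i : ℂ) • e i := by
  simp [diagUnitary, phaseBasis_apply]

@[simp]
theorem diagUnitary_symm_apply (z : Fin d → Circle) (i : Fin d) :
    (diagUnitary e z).symm (e i) = star (z i : ℂ) • e i := by
  rw [LinearIsometryEquiv.symm_apply_eq, map_smul, diagUnitary_apply, smul_smul]
  have : star (z i : ℂ) * z i = 1 := by
    rw [← starRingEnd_apply, ← Complex.normSq_eq_conj_mul_self, Circle.normSq_coe,
      Complex.ofReal_one]
  rw [this, one_smul]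

theorem conjUnitary_diagUnitary_apply (z : Fin d → Circle) (j : Fin d) :
    conjUnitary e (diagUnitary e z) (e j) = star (z j : ℂ) • e j := by
  refine e.toBasis.ext_elem fun i => ?_
  rw [e.coe_toBasis_repr_apply, e.coe_toBasis_repr_apply, e.repr_apply_apply, e.repr_apply_apply]
  refine (inner_conjOp e ((diagUnitary e z).toLinearEquiv : H →ₗ[ℂ] H) i j).trans ?_
  have : ((diagUnitary e z).toLinearEquiv : H →ₗ[ℂ] H) (e j) = (z j : ℂ) • e j :=
    diagUnitary_apply e z j
  rw [this, inner_smul_right, inner_smul_right, star_mul', e.inner_eq_ite]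
  split_ifs <;> simp

variable (A) in
/-- The projection to the `i`-th basis vector, tensored with the identity. -/
def coordProj (i : Fin d) : (H ⊗[ℂ] A) →L[ℂ] (H ⊗[ℂ] A) :=
  (InnerProductSpace.rankOne ℂ (e i) (e i)).rTensor A

theorem clm_tensor_ext {X Y : (H ⊗[ℂ] A) →L[ℂ] (H ⊗[ℂ] A)}
    (h : ∀ j a, X (e j ⊗ₜ a) = Y (e j ⊗ₜ a)) : X = Y := by
  refine ContinuousLinearMap.coe_injective (TensorProduct.ext (e.toBasis.ext fun j => ?_))
  ext a
  simpa using h j a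

theorem coordProj_tmul (i j : Fin d) (a : A) :
    coordProj e A i (e j ⊗ₜ a) = if i = j then e j ⊗ₜ a else 0 := by
  change (InnerProductSpace.rankOne ℂ (e i) (e i)) (e j) ⊗ₜ[ℂ] a = _
  rw [InnerProductSpace.rankOne_apply, e.inner_eq_ite]
  split_ifs with h
  · rw [one_smul, h]
  · simp

theorem diagUnitary_rTensor (z : Fin d → Circle) :
    (((diagUnitary e z).rTensor A : (H ⊗[ℂ] A) ≃ₗᵢ[ℂ] (H ⊗[ℂ] A)) :
      (H ⊗[ℂ] A) →L[ℂ] (H ⊗[ℂ] A)) = ∑ i, (z i : ℂ) • coordProj e A i := by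
  refine clm_tensor_ext e fun j a => ?_
  simp [coordProj_tmul, TensorProduct.smul_tmul']

theorem diagUnitary_rTensor_symm (z : Fin d → Circle) :
    (((diagUnitary e z).rTensor A : (H ⊗[ℂ] A) ≃ₗᵢ[ℂ] (H ⊗[ℂ] A)).symm :
      (H ⊗[ℂ] A) →L[ℂ] (H ⊗[ℂ] A)) = ∑ i, star (z i : ℂ) • coordProj e A i := by
  refine clm_tensor_ext e fun j a => ?_
  have : ((diagUnitary e z).rTensor A : (H ⊗[ℂ] A) ≃ₗᵢ[ℂ] (H ⊗[ℂ] A)).symm (e j ⊗ₜ a) =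
      (diagUnitary e z).symm (e j) ⊗ₜ a := rfl
  simpa [coordProj_tmul, TensorProduct.smul_tmul'] using this

/-- The phases `-1` at `i` and `1` elsewhere. -/
def signAt (i : Fin d) : Fin d → Circle := fun j => if i = j then -1 else 1

/-- Writing the projection through a unitary reflection transfers to it both symmetry and the
stability of the trace class under unitaries. -/
theorem coordProj_eq_sub (i : Fin d) : coordProj e A i = (2 : ℂ)⁻¹ •
    (ContinuousLinearMap.id ℂ _ - (((diagUnitary e (signAt i)).rTensor A :
      (H ⊗[ℂ] A) ≃ₗᵢ[ℂ] (H ⊗[ℂ] A)) : (H ⊗[ℂ] A) →L[ℂ] (H ⊗[ℂ] A))) := by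
  refine clm_tensor_ext e fun j a => ?_
  rw [diagUnitary_rTensor]
  by_cases h : i = j
  · simp [coordProj_tmul, signAt, h]
    module
  · simp [coordProj_tmul, signAt, h]

theorem diagUnitary_signAt_rTensor_symm (i : Fin d) :
    ((diagUnitary e (signAt i)).rTensor A : (H ⊗[ℂ] A) ≃ₗᵢ[ℂ] (H ⊗[ℂ] A)).symm =
      (diagUnitary e (signAt i)).rTensor A := by
  have h : (((diagUnitary e (signAt i)).rTensor A : (H ⊗[ℂ] A) ≃ₗᵢ[ℂ] (H ⊗[ℂ] A)).symm :
      (H ⊗[ℂ] A) →L[ℂ] (H ⊗[ℂ] A)) = ((diagUnitary e (signAt i)).rTensor A :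
        (H ⊗[ℂ] A) ≃ₗᵢ[ℂ] (H ⊗[ℂ] A)) := by
    rw [diagUnitary_rTensor_symm, diagUnitary_rTensor]
    refine Finset.sum_congr rfl fun j _ => ?_
    congr 1
    unfold signAt
    split_ifs <;> simp
  ext v
  exact DFunLike.congr_fun h v

theorem inner_coordProj (i : Fin d) (v w : H ⊗[ℂ] A) :
    ⟪v, coordProj e A i w⟫_ℂ = ⟪coordProj e A i v, w⟫_ℂ := by
  rw [coordProj_eq_sub]
  exact inner_half_id_sub (diagUnitary_signAt_rTensor_symm e i) v w

theorem coordProj_comp_mem_traceClass {X : (H ⊗[ℂ] A) →L[ℂ] (H ⊗[ℂ] A)}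
    (hX : X ∈ traceClass (H ⊗[ℂ] A)) (i k : Fin d) :
    coordProj e A i ∘L X ∘L coordProj e A k ∈ traceClass (H ⊗[ℂ] A) := by
  have h1 : X ∘L coordProj e A k ∈ traceClass (H ⊗[ℂ] A) := by
    rw [coordProj_eq_sub, ContinuousLinearMap.comp_smul, ContinuousLinearMap.comp_sub]
    exact Submodule.smul_mem _ _ (sub_mem hX (comp_unitary_mem_traceClass hX _))
  rw [coordProj_eq_sub e i, ContinuousLinearMap.smul_comp, ContinuousLinearMap.sub_comp]
  exact Submodule.smul_mem _ _ (sub_mem h1 (unitary_comp_mem_traceClass h1 _))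

theorem unitaryChannel_diagUnitary (z : Fin d → Circle) (X : (H ⊗[ℂ] A) →L[ℂ] (H ⊗[ℂ] A)) :
    unitaryChannel ((diagUnitary e z).rTensor A) X =
      ∑ i, ∑ k, ((z i : ℂ) * star (z k : ℂ)) • (coordProj e A i ∘L X ∘L coordProj e A k) := by
  rw [unitaryChannel, diagUnitary_rTensor, diagUnitary_rTensor_symm]
  ext v
  simp [Finset.smul_sum, smul_smul]
  rw [Finset.sum_comm]
  simp only [mul_comm]

end DiagonalUnitary

/-! ### Averaging over cubic phases and the contradiction -/

section Averaging

variable {d : ℕ}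

/-- A third root of unity at each of the `d` places. -/
def cubicPhase (n : Fin d → ZMod 3) : Fin d → Circle := fun i => ZMod.toCircle (n i)

/-- Translating by `t` multiplies the sum by a phase different from `1`. -/
theorem sum_toCircle_eq_zero (f : (Fin d → ZMod 3) →+ ZMod 3) {t : Fin d → ZMod 3} (ht : f t ≠ 0) :
    ∑ n, (ZMod.toCircle (f n) : ℂ) = 0 := by
  have h1 : ∑ n, (ZMod.toCircle (f n) : ℂ) =
      ZMod.toCircle (f t) * ∑ n, (ZMod.toCircle (f n) : ℂ) := by
    rw [Finset.mul_sum]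
    refine (Fintype.sum_equiv (Equiv.addLeft t) _ _ fun n => ?_).symm
    simp [map_add, AddChar.map_add_eq_mul]
  have h2 : (ZMod.toCircle (f t) : ℂ) ≠ 1 := by
    intro h
    apply ht
    apply ZMod.injective_toCircle
    ext
    simpa using h
  have h3 : (1 - (ZMod.toCircle (f t) : ℂ)) * ∑ n, (ZMod.toCircle (f n) : ℂ) = 0 := by
    linear_combination h1
  exact (mul_eq_zero.1 h3).resolve_left (sub_ne_zero.2 h2.symm)

/-- The exponent of the monomial `z i * z a / (z k * z b)` on cubic phases. -/
def monomialExponent (i k a b : Fin d) : (Fin d → ZMod 3) →+ ZMod 3 :=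
  Pi.evalAddMonoidHom (fun _ => ZMod 3) i + Pi.evalAddMonoidHom (fun _ => ZMod 3) a -
    Pi.evalAddMonoidHom (fun _ => ZMod 3) k - Pi.evalAddMonoidHom (fun _ => ZMod 3) b

theorem cubicPhase_monomial (n : Fin d → ZMod 3) (i k a b : Fin d) :
    (cubicPhase n i : ℂ) * star (cubicPhase n k : ℂ) *
        (cubicPhase n a * star (cubicPhase n b : ℂ)) =
      ZMod.toCircle (monomialExponent i k a b n) := by
  simp [cubicPhase, monomialExponent, sub_eq_add_neg, AddChar.map_add_eq_mul,
    AddChar.map_neg_eq_inv, ← Circle.coe_inv_eq_conj]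
  ring

/-- Unless `z i` cancels `z b` and `z a` cancels `z k`, some variable keeps an exponent `±1` or
`±2`, which is nonzero mod 3. Signs `±1` would not detect squares. -/
theorem exists_monomialExponent_ne_zero {i k a b : Fin d} (hab : a ≠ b) (h : ¬ (i = b ∧ k = a)) :
    ∃ t, monomialExponent i k a b t ≠ 0 := by
  by_cases hib : i = b
  · have hka : k ≠ a := fun hka => h ⟨hib, hka⟩
    exact ⟨Pi.single a 1, by simp [monomialExponent, Pi.single_apply, hib, hka]⟩
  by_cases hik : i = k
  · by_cases hia : i = a
    · exact ⟨Pi.single i 1, by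
        simp [monomialExponent, ← hia, ← hik, Ne.symm hib]⟩
    · exact ⟨Pi.single b 1, by
        simp [monomialExponent, ← hik, hab]⟩
  · refine ⟨Pi.single i 1, ?_⟩
    by_cases hia : a = i <;>
      simp [monomialExponent, Ne.symm hib, Ne.symm hik, hia]
    decide

theorem sum_cubicPhase_monomial (i k : Fin d) {a b : Fin d} (hab : a ≠ b) :
    ∑ n : Fin d → ZMod 3, (cubicPhase n i : ℂ) * star (cubicPhase n k : ℂ) *
        (cubicPhase n a * star (cubicPhase n b : ℂ)) =
      if i = b ∧ k = a then (Fintype.card (Fin d → ZMod 3) : ℂ) else 0 := by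
  simp only [cubicPhase_monomial]
  split_ifs with h
  · obtain ⟨rfl, rfl⟩ := h
    simp [monomialExponent]
  · obtain ⟨t, ht⟩ := exists_monomialExponent_ne_zero hab h
    exact sum_toCircle_eq_zero _ ht

theorem sum_cubicPhase_pair (i k : Fin d) :
    ∑ n : Fin d → ZMod 3, (cubicPhase n i : ℂ) * star (cubicPhase n k : ℂ) =
      if i = k then (Fintype.card (Fin d → ZMod 3) : ℂ) else 0 := by
  -- Taking `a = b = i` in the monomial inserts a factor of modulus one squared, that is `1`.
  have h (n : Fin d → ZMod 3) : (cubicPhase n i : ℂ) * star (cubicPhase n k : ℂ) =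
      ZMod.toCircle (monomialExponent i k i i n) := by
    rw [← cubicPhase_monomial]
    simp [Complex.mul_conj]
  simp only [h]
  split_ifs with hik
  · subst hik
    simp [monomialExponent]
  · refine sum_toCircle_eq_zero (t := Pi.single i 1) _ ?_
    simp [monomialExponent, Ne.symm hik]

/-- A family of positive semidefinite coefficients `ψ i k a b` in `(i, a)` and `(k, b)` such that
`∑ i k, z i * conj (z k) * ψ i k a b` is `conj (z a) * z b` times a function of the phases `z` alone
does not exist if this function has positive real part and there are three indices. -/
theorem not_exists_coefficients (hd : 3 ≤ d) (ψ : Fin d → Fin d → Fin d → Fin d → ℂ)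
    (p : (Fin d → Circle) → ℂ) (hp : ∀ z, 0 < (p z).re)
    (hψ : ∀ z a b, ∑ i, ∑ k, (z i : ℂ) * star (z k : ℂ) * ψ i k a b =
      p z * (star (z a : ℂ) * z b))
    (hpos : ∀ (i k a b : Fin d) (x y : ℂ), 0 ≤ star x * x * ψ i i a a + star x * y * ψ i k a b +
      star y * x * ψ k i b a + star y * y * ψ k k b b) : False := by
  set N : ℂ := (Fintype.card (Fin d → ZMod 3) : ℂ) with hN
  have hNpos : 0 < (Fintype.card (Fin d → ZMod 3) : ℝ) := by
    exact_mod_cast Fintype.card_pos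
  set P : ℂ := ∑ n : Fin d → ZMod 3, p (cubicPhase n) with hP
  have hPpos : 0 < P.re := by
    rw [hP, Complex.re_sum]
    exact Finset.sum_pos (fun n _ => hp _) Finset.univ_nonempty
  have hone (z : Fin d → Circle) (a : Fin d) : star (z a : ℂ) * z a = 1 := by
    simp [← Complex.normSq_eq_conj_mul_self]
  have hdiag (a : Fin d) : N * ∑ i, ψ i i a a = P := by
    have h (n : Fin d → ZMod 3) : p (cubicPhase n) = ∑ i, ∑ k,
        (cubicPhase n i : ℂ) * star (cubicPhase n k : ℂ) * ψ i k a a := by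
      rw [hψ, hone, mul_one]
    rw [hP]
    simp only [h]
    rw [Finset.sum_comm, Finset.mul_sum]
    refine Finset.sum_congr rfl fun i _ => ?_
    rw [Finset.sum_comm]
    simp only [← Finset.sum_mul, sum_cubicPhase_pair, ite_mul, zero_mul]
    simp [hN]
  -- Multiplying by `z a * conj (z b)` undoes the phase on the right, and of the double sum only `i
  -- = b`, `k = a` survives averaging.
  have hoff {a b : Fin d} (hab : a ≠ b) : N * ψ b a a b = P := by
    have h (n : Fin d → ZMod 3) : p (cubicPhase n) = ∑ i, ∑ k,
        (cubicPhase n i : ℂ) * star (cubicPhase n k : ℂ) *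
          (cubicPhase n a * star (cubicPhase n b : ℂ)) * ψ i k a b := by
      have h1 := congrArg (· * ((cubicPhase n a : ℂ) * star (cubicPhase n b : ℂ)))
        (hψ (cubicPhase n) a b)
      simp only [Finset.sum_mul] at h1
      have h2 : p (cubicPhase n) = p (cubicPhase n) * (star (cubicPhase n a : ℂ) * cubicPhase n b)
          * ((cubicPhase n a : ℂ) * star (cubicPhase n b : ℂ)) := by
        linear_combination (-p (cubicPhase n)) * (hone (cubicPhase n) a) -
          p (cubicPhase n) * (star (cubicPhase n a : ℂ) * cubicPhase n a) * hone (cubicPhase n) b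
      rw [h2, ← h1]
      refine Finset.sum_congr rfl fun i _ => Finset.sum_congr rfl fun k _ => ?_
      ring
    rw [hP]
    simp only [h]
    rw [Finset.sum_comm, Finset.sum_eq_single b]
    · rw [Finset.sum_comm, Finset.sum_eq_single a]
      · rw [← Finset.sum_mul, sum_cubicPhase_monomial _ _ hab, if_pos ⟨rfl, rfl⟩]
      · intro k _ hk
        rw [← Finset.sum_mul, sum_cubicPhase_monomial _ _ hab, if_neg (fun h => hk h.2), zero_mul]
      · simp
    · intro i _ hi
      rw [Finset.sum_comm]
      refine Finset.sum_eq_zero fun k _ => ?_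
      rw [← Finset.sum_mul, sum_cubicPhase_monomial _ _ hab, if_neg (fun h => hi h.1), zero_mul]
    · simp
  obtain ⟨q, hq⟩ : ∃ q : Fin d → Fin d → ℝ, ∀ i a, q i a = (ψ i i a a).re := ⟨_, fun _ _ => rfl⟩
  set p₀ : ℝ := P.re / Fintype.card (Fin d → ZMod 3) with hp₀
  have hre {x : ℂ} (h : N * x = P) : x.re = p₀ := by
    rw [hp₀, eq_div_iff hNpos.ne', ← h, hN, mul_comm, ← Complex.re_ofReal_mul]
    norm_cast
  have hp₀pos : 0 < p₀ := div_pos hPpos hNpos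
  have hq0 (i a : Fin d) : 0 ≤ q i a := by
    have := (Complex.le_def.1 (hpos i i a a 1 0)).1
    simpa [hq] using this
  have hqsum (a : Fin d) : ∑ i, q i a = p₀ := by
    rw [← hre (hdiag a), Complex.re_sum]
    simp [hq]
  have hq2 {a b : Fin d} (hab : a ≠ b) : 2 * p₀ ≤ q b a + q a b := by
    -- The vector `(1, -1)` gives the off-diagonal entries, both with real part `p₀`, a negative
    -- sign.
    have h1 := (Complex.le_def.1 (hpos b a a b 1 (-1))).1
    have h2 := hre (hoff hab)
    have h3 := hre (hoff hab.symm)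
    simp at h1
    rw [hq, hq]
    linarith
  have hpair {a b c : Fin d} (hbc : b ≠ c) : q b a + q c a ≤ p₀ := by
    rw [← hqsum a, ← Finset.sum_pair hbc (f := fun i => q i a)]
    exact Finset.sum_le_sum_of_subset_of_nonneg (Finset.subset_univ _) fun i _ _ => hq0 i a
  have h01 : (⟨0, by omega⟩ : Fin d) ≠ ⟨1, by omega⟩ := by simp
  have h02 : (⟨0, by omega⟩ : Fin d) ≠ ⟨2, by omega⟩ := by simp
  have h12 : (⟨1, by omega⟩ : Fin d) ≠ ⟨2, by omega⟩ := by simp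
  -- The six numbers `q i a` with distinct `i, a` among three indices sum to at least `6 p₀` by
  -- pairs and at most `3 p₀` by columns.
  have a1 := hq2 h01
  have a2 := hq2 h02
  have a3 := hq2 h12
  have b1 := hpair (a := ⟨2, by omega⟩) h01
  have b2 := hpair (a := ⟨1, by omega⟩) h02
  have b3 := hpair (a := ⟨0, by omega⟩) h12
  linarith

end Averaging

/-! ### Independence of the proportionality factor from the state -/

section Conjugation

variable {H : Type*} [NormedAddCommGroup H] [InnerProductSpace ℂ H]
variable {K : Type*} [NormedAddCommGroup K] [InnerProductSpace ℂ K]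

/-- `unitaryChannel W` as a linear map. -/
def unitaryChannelLinear (W : K ≃ₗᵢ[ℂ] K) : (K →L[ℂ] K) →ₗ[ℂ] (K →L[ℂ] K) where
  toFun := unitaryChannel W
  map_add' X Y := by ext; simp
  map_smul' c X := by ext; simp

theorem unitaryChannel_symm_unitaryChannel (W : K ≃ₗᵢ[ℂ] K) (X : K →L[ℂ] K) :
    unitaryChannel W.symm (unitaryChannel W X) = X := by
  ext
  simp

theorem trace_unitaryChannel (W : K ≃ₗᵢ[ℂ] K) (X : K →L[ℂ] K) :
    LinearMap.trace ℂ K (unitaryChannel W X : K →ₗ[ℂ] K) =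
      LinearMap.trace ℂ K (X : K →ₗ[ℂ] K) :=
  LinearMap.trace_conj' (X : K →ₗ[ℂ] K) W.toLinearEquiv

theorem isState_rankOne [FiniteDimensional ℂ H] {x : H} (hx : ‖x‖ = 1) :
    IsState (InnerProductSpace.rankOne ℂ x x) := by
  refine ⟨isPositive_rankOne x, ?_⟩
  rw [InnerProductSpace.trace_rankOne, inner_self_eq_norm_sq_to_K, hx]
  simp

theorem IsState.midpoint {ρ σ : H →L[ℂ] H} (hρ : IsState ρ) (hσ : IsState σ) :
    IsState ((2 : ℂ)⁻¹ • (ρ + σ)) := by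
  refine ⟨(hρ.isPositive.add hσ.isPositive).smul_of_nonneg ?_, ?_⟩
  · rw [inv_nonneg]
    exact zero_le_two
  · simp only [ContinuousLinearMap.toLinearMap_smul, ContinuousLinearMap.toLinearMap_add, map_smul,
      map_add, hρ.trace_eq_one, hσ.trace_eq_one]
    norm_num

/-- The trace of the output is the factor. Comparing the factors `r`, `s` of two states with that of
their midpoint, which is `(r + s) / 2`, gives `(r - s) • (ρ - σ) = 0`. -/
theorem trace_eq_of_isState {Φ : (H →L[ℂ] H) →ₗ[ℂ] (H →L[ℂ] H)} {W : H ≃ₗᵢ[ℂ] H}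
    (h : ∀ ρ, IsState ρ → ∃ c : ℂ, Φ ρ = c • unitaryChannel W ρ) {ρ σ : H →L[ℂ] H}
    (hρ : IsState ρ) (hσ : IsState σ) :
    LinearMap.trace ℂ H (Φ ρ : H →ₗ[ℂ] H) = LinearMap.trace ℂ H (Φ σ : H →ₗ[ℂ] H) := by
  obtain ⟨r, hr⟩ := h ρ hρ
  obtain ⟨s, hs⟩ := h σ hσ
  obtain ⟨m, hm⟩ := h _ (hρ.midpoint hσ)
  have key {X : H →L[ℂ] H} (hX : IsState X) {c : ℂ} (hc : Φ X = c • unitaryChannel W X) :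
      LinearMap.trace ℂ H (Φ X : H →ₗ[ℂ] H) = c ∧ unitaryChannel W.symm (Φ X) = c • X := by
    constructor
    · rw [hc, ContinuousLinearMap.toLinearMap_smul, map_smul, trace_unitaryChannel,
        hX.trace_eq_one, smul_eq_mul, mul_one]
    · rw [hc]
      exact ((unitaryChannelLinear W.symm).map_smul c _).trans
        (by exact congrArg (c • ·) (unitaryChannel_symm_unitaryChannel W X))
  obtain ⟨tr, hr'⟩ := key hρ hr
  obtain ⟨ts, hs'⟩ := key hσ hs
  obtain ⟨tm, hm'⟩ := key (hρ.midpoint hσ) hm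
  rw [map_smul, map_add, ContinuousLinearMap.toLinearMap_smul, ContinuousLinearMap.toLinearMap_add,
    map_smul, map_add, tr, ts] at tm
  have hlin : unitaryChannel W.symm (Φ ((2 : ℂ)⁻¹ • (ρ + σ))) =
      (2 : ℂ)⁻¹ • (unitaryChannel W.symm (Φ ρ) + unitaryChannel W.symm (Φ σ)) := by
    rw [map_smul, map_add]
    ext
    simp
  rw [hlin, hr', hs', ← tm] at hm'
  have h0 : (r - s) • (ρ - σ) = 0 := by
    have : (r - s) • (ρ - σ) = (4 : ℂ) • ((2 : ℂ)⁻¹ • (r • ρ + s • σ) -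
        ((2 : ℂ)⁻¹ • (r + s)) • (2 : ℂ)⁻¹ • (ρ + σ)) := by
      simp only [smul_eq_mul]
      module
    rw [this, hm', sub_self, smul_zero]
  rcases smul_eq_zero.1 h0 with h1 | h1
  · rw [tr, ts, sub_eq_zero.1 h1]
  · rw [sub_eq_zero.1 h1]

/-- A linear map which is proportional to a unitary channel on states, with a factor which may
depend on the state, is a multiple of this channel. -/
theorem exists_eq_smul_unitaryChannel [FiniteDimensional ℂ H]
    {Φ : (H →L[ℂ] H) →ₗ[ℂ] (H →L[ℂ] H)} {W : H ≃ₗᵢ[ℂ] H}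
    (h : ∀ ρ, IsState ρ → ∃ c : ℂ, Φ ρ = c • unitaryChannel W ρ) {σ : H →L[ℂ] H}
    (hσ : IsState σ) (x y : H) : Φ (InnerProductSpace.rankOne ℂ x y) =
      LinearMap.trace ℂ H (Φ σ : H →ₗ[ℂ] H) •
        unitaryChannel W (InnerProductSpace.rankOne ℂ x y) := by
  set p := LinearMap.trace ℂ H (Φ σ : H →ₗ[ℂ] H) with hp
  have hstate {ρ : H →L[ℂ] H} (hρ : IsState ρ) : Φ ρ = p • unitaryChannel W ρ := by
    obtain ⟨c, hc⟩ := h ρ hρ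
    have hcp : c = p := by
      rw [hp, ← trace_eq_of_isState h hρ hσ, hc, ContinuousLinearMap.toLinearMap_smul, map_smul,
        trace_unitaryChannel, hρ.trace_eq_one, smul_eq_mul, mul_one]
    rw [hc, hcp]
  -- The two linear maps agree on a subspace, so by polarization it suffices to test multiples of
  -- pure states.
  refine rankOne_mem_of_forall_self (S := LinearMap.eqLocus Φ (p • unitaryChannelLinear W))
    (fun u => ?_) x y
  rcases eq_or_ne u 0 with rfl | hu
  · simp
  have hn : (‖u‖ : ℂ) ≠ 0 := by simpa using hu
  have hunit : ‖((‖u‖ : ℂ)⁻¹ • u)‖ = 1 := by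
    rw [norm_smul, norm_inv, Complex.norm_real, norm_norm, inv_mul_cancel₀ (norm_ne_zero_iff.2 hu)]
  have hu2 : InnerProductSpace.rankOne ℂ u u = ((‖u‖ : ℂ) * ‖u‖) •
      InnerProductSpace.rankOne ℂ ((‖u‖ : ℂ)⁻¹ • u) ((‖u‖ : ℂ)⁻¹ • u) := by
    simp only [map_smul, map_smulₛₗ, smul_apply, smul_smul, map_inv₀, Complex.conj_ofReal]
    field_simp
    simp
  rw [hu2]
  refine Submodule.smul_mem _ _ ?_
  exact hstate (isState_rankOne hunit)

end Conjugation

/-! ### The coefficients of the protocol and their positivity -/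

section Coefficients

variable {d : ℕ} {H : Type*} [NormedAddCommGroup H] [InnerProductSpace ℂ H]
variable (e : OrthonormalBasis (Fin d) ℂ H)
variable {A : Type*} [NormedAddCommGroup A] [InnerProductSpace ℂ A]
variable (E : (H →L[ℂ] H) →ₗ[ℂ] ((H ⊗[ℂ] A) →L[ℂ] (H ⊗[ℂ] A)))
variable (D : ((H ⊗[ℂ] A) →L[ℂ] (H ⊗[ℂ] A)) →ₗ[ℂ] (H →L[ℂ] H))

/-- The coefficient of `z i * conj (z k)` in the matrix element of the protocol for the diagonal
unitary with phases `z` that takes the matrix unit `(a, b)` to itself. -/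
def protocolCoeff (i k a b : Fin d) : ℂ :=
  ⟪e a, D (coordProj e A i ∘L E (InnerProductSpace.rankOne ℂ (e a) (e b)) ∘L
    coordProj e A k) (e b)⟫_ℂ

theorem sum_protocolCoeff (z : Fin d → Circle) (a b : Fin d) :
    ∑ i, ∑ k, (z i : ℂ) * star (z k : ℂ) * protocolCoeff e E D i k a b =
      ⟪e a, D (unitaryChannel ((diagUnitary e z).rTensor A)
        (E (InnerProductSpace.rankOne ℂ (e a) (e b)))) (e b)⟫_ℂ := by
  rw [unitaryChannel_diagUnitary]
  simp [protocolCoeff]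

theorem inner_unitaryChannel_conjUnitary (z : Fin d → Circle) (a b : Fin d) :
    ⟪e a, unitaryChannel (conjUnitary e (diagUnitary e z))
      (InnerProductSpace.rankOne ℂ (e a) (e b)) (e b)⟫_ℂ = star (z a : ℂ) * z b := by
  have h (j : Fin d) : (conjUnitary e (diagUnitary e z)).symm (e j) = (z j : ℂ) • e j := by
    rw [LinearIsometryEquiv.symm_apply_eq, map_smul, conjUnitary_diagUnitary_apply, smul_smul]
    simp [Complex.mul_conj]
  rw [inner_unitaryChannel, h, h, InnerProductSpace.inner_right_rankOne_apply, inner_smul_left,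
    inner_smul_right, e.inner_eq_ite, e.inner_eq_ite]
  simp

variable {E D}

/-- The `2 × 2` block of matrix units on `e a`, `e b` is positive and stays so under `E`,
compression by `P i`, `P k`, and `D`; it is then tested on `(x • e a, y • e b)`. -/
theorem protocolCoeff_nonneg (hE : IsQuantumOperation E) (hD : IsQuantumOperation D)
    (i k a b : Fin d) (x y : ℂ) :
    0 ≤ star x * x * protocolCoeff e E D i i a a + star x * y * protocolCoeff e E D i k a b +
      star y * x * protocolCoeff e E D k i b a + star y * y * protocolCoeff e E D k k b b := by
  have hE2 := hE.completelyPositive 2 _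
    (fun _ _ => rankOne_mem_traceClass _ _) (blockPositive_rankOne ![e a, e b])
  have hP := hE2.compress (P := ![coordProj e A i, coordProj e A k]) (by
    intro r v w
    fin_cases r
    · exact inner_coordProj e i v w
    · exact inner_coordProj e k v w)
  have hD2 := hD.completelyPositive 2 _ (fun r s => by
    fin_cases r <;> fin_cases s <;>
      exact coordProj_comp_mem_traceClass e
        (hE.apply_mem_traceClass (rankOne_mem_traceClass _ _)) _ _) hP ![x • e a, y • e b]
  simp only [Fin.sum_univ_two, Matrix.cons_val_zero, Matrix.cons_val_one, map_smul,
    inner_smul_left, inner_smul_right] at hD2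
  refine hD2.trans_eq ?_
  simp only [protocolCoeff, starRingEnd_apply]
  ring

end Coefficients

end QuantumOp

end

theorem mainTheorem3 {d : ℕ} (hd : 3 ≤ d)
    {H : Type*} [NormedAddCommGroup H] [InnerProductSpace ℂ H]
    (e : OrthonormalBasis (Fin d) ℂ H)
    (A : Type*) [NormedAddCommGroup A] [InnerProductSpace ℂ A] [CompleteSpace A] :
    ¬ ∃ (ε : ℝ)
        (E : (H →L[ℂ] H) →ₗ[ℂ] ((H ⊗[ℂ] A) →L[ℂ] (H ⊗[ℂ] A)))
        (D : ((H ⊗[ℂ] A) →L[ℂ] (H ⊗[ℂ] A)) →ₗ[ℂ] (H →L[ℂ] H)),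
      0 < ε ∧ QuantumOp.IsQuantumOperation E ∧ QuantumOp.IsQuantumOperation D ∧
      ∀ (U : H ≃ₗᵢ[ℂ] H) (ρ : H →L[ℂ] H), QuantumOp.IsState ρ →
        ε ≤ (LinearMap.trace ℂ H
          (D (QuantumOp.unitaryChannel (U.rTensor A) (E ρ)) : H →ₗ[ℂ] H)).re ∧
        ∃ c : ℂ, D (QuantumOp.unitaryChannel (U.rTensor A) (E ρ)) =
          c • QuantumOp.unitaryChannel (QuantumOp.conjUnitary e U) ρ := by
  rintro ⟨ε, E, D, hε, hE, hD, h⟩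
  have : FiniteDimensional ℂ H := e.toBasis.finiteDimensional_of_finite
  let σ := InnerProductSpace.rankOne ℂ (e ⟨0, by omega⟩) (e ⟨0, by omega⟩)
  have hσ : QuantumOp.IsState σ := QuantumOp.isState_rankOne (e.norm_eq_one _)
  -- Here `p z` is the success probability on the fixed state `σ`, bounded below by `ε`.
  refine QuantumOp.not_exists_coefficients hd (QuantumOp.protocolCoeff e E D)
    (fun z => LinearMap.trace ℂ H (D (QuantumOp.unitaryChannel
      ((QuantumOp.diagUnitary e z).rTensor A) (E σ)) : H →ₗ[ℂ] H))
    (fun z => hε.trans_le (h _ σ hσ).1) (fun z a b => ?_)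
    (QuantumOp.protocolCoeff_nonneg e hE hD)
  have hΦ := QuantumOp.exists_eq_smul_unitaryChannel
    (Φ := D ∘ₗ QuantumOp.unitaryChannelLinear ((QuantumOp.diagUnitary e z).rTensor A) ∘ₗ E)
    (fun ρ hρ => (h (QuantumOp.diagUnitary e z) ρ hρ).2) hσ (e a) (e b)
  rw [QuantumOp.sum_protocolCoeff]
  have h2 := congrArg (fun X : H →L[ℂ] H => ⟪e a, X (e b)⟫_ℂ) hΦ
  refine h2.trans ?_
  simp only [smul_apply, inner_smul_right, QuantumOp.inner_unitaryChannel_conjUnitary]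
  rfl
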